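/- A $k$-pair network consists of a finite directed acyclic graph with vertex set $V$ and arc set $A$ (parallel arcs allowed), $k$ distinct sources $s_1,\dots,s_k\in V$ of in-degree zero and $k$ distinct sinks $t_1,\dots,t_k\in V$ of out-degree zero. A path system is a choice of a directed path $P_{s_i,t_j}$ from $s_i$ to $t_j$ for all $i,j$. It is called strong if for every $j$ the paths $P_{s_1,t_j},\dots,P_{s_k,t_j}$ are pairwise edge-disjoint, and extra strong if it is strong and, for every $j$, any two of these paths share no vertex other than $t_j$. The network is called stable if it has exactly one strong path system, and we also admit the networks that have exactly one extra strong path system. For $f:A\to\mathbb R$ and $v\in V$ let $\mathrm{excess}_f(v)=\sum_{\mathrm{head}(a)=v}f(a)-\sum_{\mathrm{tail}(a)=v}f(a)$. A multi-flow is a family $\mathcal F=(f_1,\dots,f_k)$ of functions $f_l:A\to\mathbb R$ with $\mathrm{excess}_{f_l}(v)=0$ for all $v\notin\{s_l,t_l\}$; its rate is $(d_1,\dots,d_k)$ with $d_l=\mathrm{excess}_{f_l}(t_l)$ $(=-\mathrm{excess}_{f_l}(s_l))$; it is feasible if $\sum_{l}|f_l(a)|\le 1$ for every arc $a$. A feasible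 multi-flow of rate $(1,\dots,1)$ is called a routing solution. It is linear with respect to a path system if every $f_l$ is a real linear combination $f_l=\sum_{i,j}c^{(l)}_{i,j}f_{i,j}$ of the path flows $f_{i,j}$, where $f_{i,j}(a)=1$ if $a\in P_{s_i,t_j}$ and $f_{i,j}(a)=0$ otherwise. **Theorem.** Let $\mathcal N$ be a $3$-pair network that has exactly one strong path system, or exactly one extra strong path system. Then $\mathcal N$ has an extra strong path system (necessarily the unique one) with respect to which there is a linear routing solution. In particular $\mathcal N$ has a feasible undirected fractional multi-flow of rate $(1,1,1)$. -/

import Mathlib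

/-- `IsDiWalk tail head u p w`: the list of arcs `p` is a directed walk from `u` to `w`. In an acyclic
digraph such a walk repeats no vertex, so directed walks and directed paths are the same thing. -/
def IsDiWalk {V A : Type*} (tail head : A → V) : V → List A → V → Prop
  | u, [], w => u = w
  | u, a :: p, w => tail a = u ∧ IsDiWalk tail head (head a) p w

/-- A `k`-pair network with vertices `V` and arcs `A` (parallel arcs are allowed): a directed acyclic
graph with `k` distinct sources of in-degree zero and `k` distinct sinks of out-degree zero. -/
structure PairNetwork (V A : Type*) (k : ℕ) where
  tail : A → V
  head : A → V
  acyclic : ∀ (v : V) (p : List A), IsDiWalk tail head v p v → p = []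
  source : Fin k → V
  sink : Fin k → V
  source_injective : Function.Injective source
  sink_injective : Function.Injective sink
  head_ne_source : ∀ (a : A) (i : Fin k), head a ≠ source i
  tail_ne_sink : ∀ (a : A) (j : Fin k), tail a ≠ sink j

namespace PairNetwork

variable {V A : Type*} {k : ℕ} (N : PairNetwork V A k)

/-- A choice of directed paths `P i j` from `s_i` to `t_j`, for all `i` and `j`. -/
def IsPathSystem (P : Fin k → Fin k → List A) : Prop :=
  ∀ i j, IsDiWalk N.tail N.head (N.source i) (P i j) (N.sink j)

/-- For every `j`, the paths `P 1 j, …, P k j` into `t_j` are edge-disjoint. A network is strongly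
reachable if it has such a path system. -/
def IsStrongPathSystem (P : Fin k → Fin k → List A) : Prop :=
  N.IsPathSystem P ∧ ∀ j i i', i ≠ i' → ∀ a, a ∈ P i j → a ∉ P i' j

/-- The vertices of the path with arc list `p` that starts at `u`. -/
def pathVertices (u : V) (p : List A) : List V :=
  u :: p.map N.head

/-- In addition, for every `j`, two different paths into `t_j` share no vertex other than `t_j`.
A network is extra strongly reachable if it has such a path system. -/
def IsExtraStrongPathSystem (P : Fin k → Fin k → List A) : Prop :=
  N.IsStrongPathSystem P ∧ ∀ j i i', i ≠ i' → ∀ v,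
    v ∈ N.pathVertices (N.source i) (P i j) → v ∈ N.pathVertices (N.source i') (P i' j) →
      v = N.sink j

/-- The network is strongly reachable and the choice of the paths, edge-disjoint for each sink,
is unique. -/
def IsStable : Prop :=
  ∃! P : Fin k → Fin k → List A, N.IsStrongPathSystem P

/-- The network is extra strongly reachable and the choice of the paths, disjoint in vertices
except for the common sink, is unique. -/
def IsExtraStable : Prop :=
  ∃! P : Fin k → Fin k → List A, N.IsExtraStrongPathSystem P

section Flows

variable [Fintype A]

open Classical in
/-- Inflow minus outflow of `f` at the vertex `v`. -/
noncomputable def excess (f : A → ℝ) (v : V) : ℝ :=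
  (∑ a with N.head a = v, f a) - ∑ a with N.tail a = v, f a

/-- `f` is an `s`-`t` flow; its values may be negative, as arcs may be used in both directions. -/
def IsFlow (s t : V) (f : A → ℝ) : Prop :=
  ∀ v, v ≠ s → v ≠ t → N.excess f v = 0

/-- `F` is an `(s_1, …, s_k)`-`(t_1, …, t_k)` multi-flow. -/
def IsMultiFlow (F : Fin k → A → ℝ) : Prop :=
  ∀ l, N.IsFlow (N.source l) (N.sink l) (F l)

/-- The rate of the `l`-th flow: its excess at `t_l`, which by conservation is its net outflow
at `s_l`. -/
noncomputable def rate (F : Fin k → A → ℝ) (l : Fin k) : ℝ :=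
  N.excess (F l) (N.sink l)

/-- A routing solution: a feasible multi-flow of rate `(1, …, 1)`. -/
structure IsRoutingSolution (F : Fin k → A → ℝ) : Prop where
  isMultiFlow : N.IsMultiFlow F
  rate_eq_one : ∀ l, N.rate F l = 1
  feasible : ∀ a, ∑ l, |F l a| ≤ 1

end Flows

end PairNetwork

open Classical in
/-- The path flow `f_{i,j}` of the path with arc list `p`. -/
noncomputable def pathFlow {A : Type*} (p : List A) (a : A) : ℝ :=
  if a ∈ p then 1 else 0

/-- Each flow of `F` is a real linear combination of the path flows `f_{i,j}` of `P`. -/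
def IsLinearMultiFlow {A : Type*} {k : ℕ} (P : Fin k → Fin k → List A) (F : Fin k → A → ℝ) : Prop :=
  ∀ l, ∃ c : Fin k → Fin k → ℝ, ∀ a, F l a = ∑ i, ∑ j, c i j * pathFlow (P i j) a

/-! ### Directed walks -/

section Walks

variable {V A : Type*} {tail head : A → V}

/-! Uniqueness acts through rerouting: disjoint paths from all sources to one sink must be the given
ones (`exchange`, `eq_of_avoids`). A unique strong system is extra strong, since two paths into one
sink that share a vertex could swap their ends there.

Rerouting restricts how paths into different sinks interact. Follow each path into one sink up to
the first path of another source into a second sink; the sources so reached cannot form a cycle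
(`perm_eq_one`). For three sources, using both directions, the meetings between paths into two sinks
then respect a linear order of the sources (`exists_rankTable`). For a source at an end of this
order, the arcs shared by its paths into the two sinks form initial segments (`sharesInitial`),
which limits the pairs of its paths that share arcs off the third one. One more combination of such
pairs is excluded by `not_crosswise`.

The load of a linear multi-flow on an arc depends only on the paths through it, at most one per
sink, so there are 64 arc types. Flow conservation and the rate hold once the coefficient matrices
have the row and column sums of matrix units (`isMultiFlow_of_sums`). It remains to check that for
all three orders and every admissible set of pair types some row of `routingTable` respects the
capacities on all types that can occur (`allCovered_eq_true`). -/

theorem IsDiWalk.append {u v w : V} {p q : List A} (hp : IsDiWalk tail head u p v)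
    (hq : IsDiWalk tail head v q w) : IsDiWalk tail head u (p ++ q) w := by
  induction p generalizing u with
  | nil => cases hp; exact hq
  | cons a p ih => exact ⟨hp.1, ih hp.2⟩

theorem IsDiWalk.split {u w : V} {p q : List A} {a : A}
    (h : IsDiWalk tail head u (p ++ a :: q) w) :
    IsDiWalk tail head u p (tail a) ∧ IsDiWalk tail head (tail a) (a :: q) w := by
  induction p generalizing u with
  | nil => exact ⟨h.1.symm, rfl, h.2⟩
  | cons b p ih => exact ⟨⟨h.1, (ih h.2).1⟩, (ih h.2).2⟩

theorem IsDiWalk.vertices_eq {u w : V} {p : List A} (h : IsDiWalk tail head u p w) :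
    u :: p.map head = p.map tail ++ [w] := by
  induction p generalizing u with
  | nil => cases h; rfl
  | cons a p ih => simp [← ih h.2, h.1]

theorem List.exists_first {A : Type*} {p : List A} {S : A → Prop} (h : ∃ a ∈ p, S a) :
    ∃ x a y, p = x ++ a :: y ∧ S a ∧ ∀ b ∈ x, ¬ S b := by
  induction p with
  | nil => simp at h
  | cons b p ih =>
    by_cases hb : S b
    · exact ⟨[], b, p, rfl, hb, by simp⟩
    · obtain ⟨x, a, y, rfl, ha, hx⟩ := ih (by simpa [hb] using h)
      exact ⟨b :: x, a, y, rfl, ha, by simpa [hb] using hx⟩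

end Walks

/-! ### Meeting paths, uniqueness and rerouting -/

namespace PairNetwork

variable {V A : Type*} {k : ℕ} (N : PairNetwork V A k)

/-- Two arc lists meet if an arc of the one and an arc of the other have the same tail. -/
def Meets (p q : List A) : Prop := ∃ a ∈ p, ∃ b ∈ q, N.tail a = N.tail b

variable {N} {P : Fin k → Fin k → List A}

theorem Meets.symm {p q : List A} (h : N.Meets p q) : N.Meets q p := by
  obtain ⟨a, ha, b, hb, hab⟩ := h
  exact ⟨b, hb, a, ha, hab.symm⟩

theorem Meets.mono {p q p' q' : List A} (h : N.Meets p q) (hp : p ⊆ p') (hq : q ⊆ q') :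
    N.Meets p' q' := by
  obtain ⟨a, ha, b, hb, hab⟩ := h
  exact ⟨a, hp ha, b, hq hb, hab⟩

theorem not_meets_nil {q : List A} : ¬ N.Meets [] q := by simp [Meets]

theorem meets_of_mem {p q : List A} {a : A} (hp : a ∈ p) (hq : a ∈ q) : N.Meets p q :=
  ⟨a, hp, a, hq, rfl⟩

theorem meets_append_left {p p' q : List A} :
    N.Meets (p ++ p') q ↔ N.Meets p q ∨ N.Meets p' q := by
  simp only [Meets, List.mem_append]
  constructor
  · rintro ⟨a, ha | ha, h⟩
    exacts [Or.inl ⟨a, ha, h⟩, Or.inr ⟨a, ha, h⟩]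
  · rintro (⟨a, ha, h⟩ | ⟨a, ha, h⟩)
    exacts [⟨a, Or.inl ha, h⟩, ⟨a, Or.inr ha, h⟩]

/-- Sinks have no outgoing arcs, so the tails of the arcs of a path into a sink are exactly its
vertices other than that sink. -/
theorem isExtraStrongPathSystem_iff :
    N.IsExtraStrongPathSystem P ↔
      N.IsPathSystem P ∧ ∀ j i i', i ≠ i' → ¬ N.Meets (P i j) (P i' j) := by
  constructor
  · rintro ⟨⟨h, -⟩, h'⟩
    refine ⟨h, fun j i i' hi ⟨a, ha, b, hb, hab⟩ => N.tail_ne_sink a j ?_⟩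
    refine h' j i i' hi _ ?_ ?_
    · rw [pathVertices, (h i j).vertices_eq]
      exact List.mem_append_left _ (List.mem_map_of_mem ha)
    · rw [pathVertices, (h i' j).vertices_eq, hab]
      exact List.mem_append_left _ (List.mem_map_of_mem hb)
  · rintro ⟨h, h'⟩
    refine ⟨⟨h, fun j i i' hi a ha ha' => h' j i i' hi (meets_of_mem ha ha')⟩, ?_⟩
    intro j i i' hi v hv hv'
    rw [pathVertices, (h _ j).vertices_eq] at hv hv'
    simp only [List.mem_append, List.mem_map, List.mem_singleton] at hv hv'
    rcases hv with ⟨a, ha, rfl⟩ | rfl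
    · rcases hv' with ⟨b, hb, hab⟩ | hv'
      · exact (h' j i i' hi ⟨a, ha, b, hb, hab.symm⟩).elim
      · exact hv'
    · rfl

/-- `P` is the only extra strong path system of `N`. -/
def IsUniqueSystem (N : PairNetwork V A k) (P : Fin k → Fin k → List A) : Prop :=
  N.IsExtraStrongPathSystem P ∧ ∀ P', N.IsExtraStrongPathSystem P' → P' = P

theorem nodup_of_isDiWalk {u w : V} {p : List A} (h : IsDiWalk N.tail N.head u p w) :
    p.Nodup := by
  induction p generalizing u with
  | nil => exact List.nodup_nil
  | cons a p ih =>
    refine List.nodup_cons.2 ⟨fun ha => ?_, ih h.2⟩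
    obtain ⟨x, y, rfl⟩ := List.append_of_mem ha
    have := N.acyclic (N.tail a) (a :: x) ⟨rfl, h.2.split.1⟩
    simp at this

/-- Swapping the ends of two paths at a shared vertex keeps the family edge-disjoint, because no arc
outside the two paths is used and neither path repeats an arc. Uniqueness then forces `a = b`, an
arc on both paths. -/
theorem IsStable.exists_isUniqueSystem (h : N.IsStable) : ∃ P, N.IsUniqueSystem P := by
  obtain ⟨P, ⟨hw, hs⟩, hu⟩ := h
  refine ⟨P, isExtraStrongPathSystem_iff.2 ⟨hw, ?_⟩, fun P' hP' => hu P' hP'.1⟩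
  rintro j i i' hi ⟨a, ha, b, hb, hab⟩
  obtain ⟨x, y, hxy⟩ := List.append_of_mem ha
  obtain ⟨x', y', hxy'⟩ := List.append_of_mem hb
  have hw₁ := (hxy ▸ hw i j).split
  have hw₂ := (hxy' ▸ hw i' j).split
  have hn₁ := List.disjoint_of_nodup_append (hxy ▸ nodup_of_isDiWalk (hw i j))
  have hn₂ := List.disjoint_of_nodup_append (hxy' ▸ nodup_of_isDiWalk (hw i' j))
  let R : Fin k → List A := fun m => if m = i then x ++ b :: y' else if m = i' then x' ++ a :: y
    else P m j
  have hRi : R i = x ++ b :: y' := by simp [R]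
  have hRi' : R i' = x' ++ a :: y := by simp [R, hi.symm]
  have hRm : ∀ m, m ≠ i → m ≠ i' → R m = P m j := fun m h₁ h₂ => by simp [R, h₁, h₂]
  have hij : ∀ e, e ∈ x ∨ e ∈ a :: y ↔ e ∈ P i j := fun e => by rw [hxy, List.mem_append]
  have hij' : ∀ e, e ∈ x' ∨ e ∈ b :: y' ↔ e ∈ P i' j := fun e => by rw [hxy', List.mem_append]
  have hd : ∀ m m', m ≠ m' → ∀ e, e ∈ R m → e ∉ R m' := by
    have key : ∀ e, e ∈ R i → e ∉ R i' := by
      intro e he he'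
      rw [hRi, List.mem_append] at he
      rw [hRi', List.mem_append] at he'
      rcases he with he | he <;> rcases he' with he' | he'
      · exact hs j i i' hi e ((hij e).1 (.inl he)) ((hij' e).1 (.inl he'))
      · exact hn₁ he he'
      · exact hn₂ he' he
      · exact hs j i i' hi e ((hij e).1 (.inr he')) ((hij' e).1 (.inr he))
    have hsub : ∀ e, e ∈ R i ∨ e ∈ R i' → e ∈ P i j ∨ e ∈ P i' j := by
      intro e he
      rw [hRi, hRi', List.mem_append, List.mem_append] at he
      rw [← hij, ← hij']
      tauto
    have key₂ : ∀ m, m ≠ i → m ≠ i' → ∀ e, e ∈ R i ∨ e ∈ R i' → e ∉ R m := by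
      intro m h₁ h₂ e he he'
      rw [hRm m h₁ h₂] at he'
      rcases hsub e he with h | h
      · exact hs j m i h₁ e he' h
      · exact hs j m i' h₂ e he' h
    intro m m' hm e he he'
    by_cases h₁ : m = i <;> by_cases h₂ : m' = i <;> by_cases h₃ : m = i' <;>
      by_cases h₄ : m' = i' <;> subst_vars <;>
      first
      | exact hm rfl
      | exact key e he he'
      | exact key e he' he
      | exact key₂ _ ‹_› ‹_› e (.inl he) he'
      | exact key₂ _ ‹_› ‹_› e (.inr he) he'
      | exact key₂ _ ‹_› ‹_› e (.inl he') he
      | exact key₂ _ ‹_› ‹_› e (.inr he') he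
      | (rw [hRm m h₁ h₃] at he; rw [hRm m' h₂ h₄] at he'; exact hs j m m' hm e he he')
  have := hu (fun m l => if l = j then R m else P m l) ⟨fun m l => ?_, fun l m m' hm => ?_⟩
  · have h₁ := congrFun (congrFun this i) j
    simp only [if_true, hRi] at h₁
    rw [hxy, List.append_cancel_left_eq, List.cons.injEq] at h₁
    exact hs j i i' hi a ha (h₁.1 ▸ hb)
  · by_cases hl : l = j
    · subst hl
      simp only [if_true]
      by_cases h₁ : m = i
      · subst h₁; rw [hRi]; exact hw₁.1.append (hab ▸ hw₂.2)
      by_cases h₂ : m = i'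
      · subst h₂; rw [hRi']; exact hw₂.1.append (hab ▸ hw₁.2)
      rw [hRm m h₁ h₂]; exact hw m l
    · simpa [hl] using hw m l
  · by_cases hl : l = j
    · simpa [hl] using hd m m' hm
    · simpa [hl] using hs l m m' hm

namespace IsUniqueSystem

theorem isDiWalk (hP : N.IsUniqueSystem P) (i j : Fin k) :
    IsDiWalk N.tail N.head (N.source i) (P i j) (N.sink j) :=
  (isExtraStrongPathSystem_iff.1 hP.1).1 i j

theorem not_meets (hP : N.IsUniqueSystem P) {i i' j : Fin k} (hi : i ≠ i') :
    ¬ N.Meets (P i j) (P i' j) :=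
  (isExtraStrongPathSystem_iff.1 hP.1).2 j i i' hi

/-- Disjointness is required for each sink separately, so the paths into `j` alone can be replaced
and uniqueness applied to the result. -/
theorem eq_of_not_meets (hP : N.IsUniqueSystem P) (j : Fin k) (R : Fin k → List A)
    (hR : ∀ i, IsDiWalk N.tail N.head (N.source i) (R i) (N.sink j))
    (hd : ∀ i i', i ≠ i' → ¬ N.Meets (R i) (R i')) (i : Fin k) : R i = P i j := by
  have := hP.2 (fun m l => if l = j then R m else P m l)
    (isExtraStrongPathSystem_iff.2 ⟨fun m l => ?_, fun l m m' hm => ?_⟩)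
  · simpa using congrFun (congrFun this i) j
  · by_cases hl : l = j
    · subst hl; simpa using hR m
    · simpa [hl] using hP.isDiWalk m l
  · by_cases hl : l = j
    · simpa [hl] using hd m m' hm
    · simpa [hl] using hP.not_meets hm

/-- Rerouting: walks `W i` from the sources that are continued along the ends `Q i` of the paths
into a fixed sink. -/
theorem exchange (hP : N.IsUniqueSystem P) (j : Fin k) (σ : Equiv.Perm (Fin k))
    (W X Q : Fin k → List A) (y : Fin k → V)
    (hW : ∀ i, IsDiWalk N.tail N.head (N.source i) (W i) (y i))
    (hQ : ∀ i, IsDiWalk N.tail N.head (y i) (Q i) (N.sink j))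
    (hX : ∀ i, P (σ i) j = X i ++ Q i)
    (hd : ∀ i i', i ≠ i' → ¬ N.Meets (W i) (W i'))
    (hd' : ∀ i i', i ≠ i' → ¬ N.Meets (W i) (Q i')) (i : Fin k) : W i ++ Q i = P i j := by
  refine hP.eq_of_not_meets j (fun i => W i ++ Q i) (fun i => (hW i).append (hQ i)) ?_ i
  intro i i' hi h
  rcases meets_append_left.1 h with h | h <;> rcases meets_append_left.1 h.symm with h | h
  · exact hd i i' hi h.symm
  · exact hd' i i' hi h.symm
  · exact hd' i' i hi.symm h
  · refine hP.not_meets (σ.injective.ne hi) (h.symm.mono (?_ : _ ⊆ P (σ i) j) ?_) <;>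
    · rw [hX]; exact List.subset_append_right _ _

/-- A walk from the source of a path to a vertex of it that avoids the other paths into the same
sink follows the path. -/
theorem eq_of_avoids (hP : N.IsUniqueSystem P) {a j : Fin k} {W X Q : List A} {g : A}
    (hX : P a j = X ++ g :: Q) (hW : IsDiWalk N.tail N.head (N.source a) W (N.tail g))
    (hd : ∀ x, x ≠ a → ¬ N.Meets W (P x j)) : W = X := by
  classical
  have hg := (hX ▸ hP.isDiWalk a j).split
  -- Only `a` is rerouted; every other source gets an empty walk and keeps its whole path.
  have := hP.exchange j 1 (fun i => if i = a then W else []) (fun i => if i = a then X else [])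
    (fun i => if i = a then g :: Q else P i j) (fun i => if i = a then N.tail g else N.source i)
    ?_ ?_ ?_ ?_ ?_ a
  · simp only [if_true] at this
    rw [hX] at this
    exact List.append_cancel_right this
  · intro i
    by_cases h : i = a
    · subst h; simpa using hW
    · simp [h, IsDiWalk]
  · intro i
    by_cases h : i = a
    · subst h; simpa using hg.2
    · simpa [h] using hP.isDiWalk i j
  · intro i
    by_cases h : i = a
    · subst h; simpa using hX
    · simp [h]
  · intro i i' hi
    by_cases h : i = a
    · have h' : i' ≠ a := fun h' => hi (h.trans h'.symm)
      simpa [h'] using fun h => not_meets_nil (Meets.symm h)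
    · simpa [h] using not_meets_nil
  · intro i i' hi
    by_cases h : i = a
    · have h' : i' ≠ a := fun h' => hi (h.trans h'.symm)
      simpa [h, h'] using hd i' h'
    · simpa [h] using not_meets_nil

end IsUniqueSystem
end PairNetwork

/-! ### Interaction of paths into different sinks -/

namespace PairNetwork

variable {V A : Type*} {k : ℕ} {N : PairNetwork V A k} {P : Fin k → Fin k → List A}

/-- The arcs that the path `p` shares with `q` form an initial segment of `p`. -/
def SharesInitial (p q : List A) : Prop :=
  ∀ x e y, p = x ++ e :: y → e ∈ q → x ⊆ q

theorem SharesInitial.mem {p q x y : List A} {e g : A} (h : SharesInitial p q)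
    (hp : p = x ++ g :: y) (he : e ∈ p) (heq : e ∈ q) (hex : e ∉ x) : g ∈ q := by
  rw [hp, List.mem_append, List.mem_cons] at he
  rcases he with he | rfl | he
  · exact (hex he).elim
  · exact heq
  · obtain ⟨z, w, rfl⟩ := List.append_of_mem he
    exact h (x ++ g :: z) e w (by simp [hp]) heq (by simp)

/-- Whichever of `e` and `f` comes later on `p` drags the earlier one into the path it lies on. -/
theorem SharesInitial.not_both {p q r : List A} {e f : A} (hq : SharesInitial p q)
    (hr : SharesInitial p r) (he : e ∈ p) (heq : e ∈ q) (her : e ∉ r) (hf : f ∈ p)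
    (hfr : f ∈ r) (hfq : f ∉ q) : False := by
  obtain ⟨x, y, rfl⟩ := List.append_of_mem he
  by_cases hfx : f ∈ x
  · exact hfq (hq x e y rfl heq hfx)
  · exact her (hr.mem rfl hf hfr hfx)

namespace IsUniqueSystem

/-- Up to a common arc, one of the two paths avoids all foreign paths into the sink of the other, so
`eq_of_avoids` makes the two coincide there. -/
theorem sharesInitial (hP : N.IsUniqueSystem P) {a j l : Fin k}
    (h : (∀ x, x ≠ a → ¬ N.Meets (P a j) (P x l)) ∨ ∀ x, x ≠ a → ¬ N.Meets (P a l) (P x j)) :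
    SharesInitial (P a j) (P a l) := by
  intro x e y hx he
  obtain ⟨x', y', hx'⟩ := List.append_of_mem he
  have hw := (hx ▸ hP.isDiWalk a j).split.1
  have hw' := (hx' ▸ hP.isDiWalk a l).split.1
  have : x = x' := by
    rcases h with h | h
    · exact hP.eq_of_avoids hx' hw
        fun z hz hm => h z hz (hm.mono (by rw [hx]; exact List.subset_append_left _ _)
          (List.Subset.refl _))
    · exact (hP.eq_of_avoids hx hw'
        fun z hz hm => h z hz (hm.mono (by rw [hx']; exact List.subset_append_left _ _)
          (List.Subset.refl _))).symm
  rw [hx', this]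
  exact List.subset_append_left _ _

/-- A path that has not yet met another path into `t_j` runs along the path into `t_j` of its own
source, up to any vertex of the latter. -/
theorem eq_of_first_meet (hP : N.IsUniqueSystem P) {a j l : Fin k} {p q u r X Y : List A} {n h : A}
    (hl : P a l = p ++ q) (hp : ∀ x, x ≠ a → ¬ N.Meets p (P x j)) (hu : p = u ++ n :: r)
    (hX : P a j = X ++ h :: Y) (hn : N.tail n = N.tail h) : u = X := by
  refine hP.eq_of_avoids hX ?_
    fun x hx hm => hp x hx (hm.mono (by rw [hu]; exact List.subset_append_left _ _)
      (List.Subset.refl _))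
  have := hP.isDiWalk a l
  rw [hl, hu, List.append_assoc] at this
  exact hn ▸ this.split.1

/-- The paths into `t_l`, each followed up to its first vertex on a path of another source into
`t_j`, cannot permute the sources nontrivially. -/
theorem perm_eq_one (hP : N.IsUniqueSystem P) {j l : Fin k} (σ : Equiv.Perm (Fin k))
    (h : ∀ i, σ i ≠ i → ∃ p g q, P i l = p ++ g :: q ∧ (∃ g' ∈ P (σ i) j, N.tail g = N.tail g') ∧
      ∀ x, x ≠ i → ¬ N.Meets p (P x j)) : σ = 1 := by
  classical
  -- A moved source walks to its first meeting and continues on the path of `σ i`; a fixed one has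
  -- the empty walk and its own path.
  have key : ∀ i, ∃ W X Q y, P (σ i) j = X ++ Q ∧
      IsDiWalk N.tail N.head (N.source i) W y ∧ IsDiWalk N.tail N.head y Q (N.sink j) ∧
      (∃ R, P i l = W ++ R) ∧ (∀ x, x ≠ i → ¬ N.Meets W (P x j)) ∧
      (σ i = i → W = []) ∧
      (σ i ≠ i → ∃ g ∈ P i l, ∃ g' Y, N.tail g = N.tail g' ∧ Q = g' :: Y) := by
    intro i
    by_cases hi : σ i = i
    · exact ⟨[], [], P i j, N.source i, by rw [hi]; rfl, rfl, hP.isDiWalk i j, ⟨_, rfl⟩,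
        fun _ _ => not_meets_nil, fun _ => rfl, fun h => (h hi).elim⟩
    · obtain ⟨p, g, q, hl, ⟨g', hg', hgg⟩, hp⟩ := h i hi
      obtain ⟨X, Y, hX⟩ := List.append_of_mem hg'
      have hw := (hl ▸ hP.isDiWalk i l).split
      have hw' := (hX ▸ hP.isDiWalk (σ i) j).split
      exact ⟨p, X, g' :: Y, N.tail g, hX, hw.1, hgg ▸ hw'.2, ⟨_, hl⟩, hp,
        fun h => (hi h).elim, fun _ => ⟨g, by simp [hl], g', Y, hgg, rfl⟩⟩
  choose W X Q y hX hW hQ hR hav hnil hcons using key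
  have hWl : ∀ i, W i ⊆ P i l := fun i => by
    obtain ⟨R, hR⟩ := hR i
    rw [hR]; exact List.subset_append_left _ _
  have hQj : ∀ i, Q i ⊆ P (σ i) j := fun i => by
    rw [hX]; exact List.subset_append_right _ _
  have := hP.exchange j σ W X Q y hW hQ hX
    (fun i i' hi hm => hP.not_meets hi (hm.mono (hWl i) (hWl i'))) ?_
  · ext i
    by_contra hi
    obtain ⟨g, -, g', Y, -, hg'⟩ := hcons i (fun h => hi (by rw [h]; rfl))
    refine hP.not_meets (j := j) (i := i) (i' := σ i) (fun h => hi (by rw [← h]; rfl))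
      (meets_of_mem (a := g') ?_ (hQj i (by simp [hg'])))
    rw [← this i, hg']; simp
  · intro i i' hi hm
    -- `W i` avoids foreign paths, so only `Q i'` on the path of `i` itself is in question. There `W
    -- i` follows `P i j` to or past the vertex where `W i'` joined it, so `P i l` and `P i' l`
    -- would meet.
    have h₁ : σ i' = i := by
      by_contra h₁
      exact hav i _ h₁ (hm.mono (List.Subset.refl _) (hQj i'))
    obtain ⟨g, hg, g', Y, hgg, hQ'⟩ := hcons i' (fun h₂ => hi (h₁ ▸ h₂))
    obtain ⟨n, hn, m, hm, hnm⟩ := hm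
    obtain ⟨u, r, hu⟩ := List.append_of_mem hn
    obtain ⟨S, T, hS⟩ := List.append_of_mem hm
    obtain ⟨R, hR⟩ := hR i
    have hij : P i j = (X i' ++ S) ++ m :: T := by
      rw [← h₁, hX, hS, List.append_assoc]
    have hXu := hP.eq_of_first_meet hR (hav i) hu hij hnm
    refine hP.not_meets hi ?_ (j := l)
    rcases S with _ | ⟨s, S⟩
    · rw [hQ', List.nil_append, List.cons.injEq] at hS
      exact ⟨n, hWl i hn, g, hg, by rw [hnm, hgg, hS.1]⟩
    · rw [hQ', List.cons_append, List.cons.injEq] at hS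
      refine ⟨g', hWl i ?_, g, hg, hgg.symm⟩
      rw [hu, hXu, hS.1]; simp

/-- Rerouting in `t_a`: the path from `s_a` to `t_c`, up to the path of `s_b`, and the path from
`s_b` to `t_b`, up to the path of `s_a`, cannot both leave the paths into `t_a` before the
comparison paths from `s_a` to `t_b` and from `s_b` to `t_c` separate. -/
theorem not_crosswise (hP : N.IsUniqueSystem P) {a b c : Fin k} (hab : a ≠ b)
    (h₁ : ∀ x, x ≠ a → ¬ N.Meets (P a b) (P x a)) (h₂ : ∀ x, x ≠ b → ¬ N.Meets (P b c) (P x b))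
    (h₃ : ∀ x, x ≠ a → x ≠ b → ¬ N.Meets (P a c) (P x a))
    (h₄ : ∀ x, x ≠ a → x ≠ b → ¬ N.Meets (P b b) (P x a))
    (d₁ : ∃ e ∈ P a a, e ∈ P a b ∧ e ∉ P a c) (d₂ : ∃ e ∈ P a a, e ∈ P a c ∧ e ∉ P a b)
    (d₃ : ∃ e ∈ P b b, e ∈ P b c ∧ e ∉ P b a) (d₄ : ∃ e ∈ P b b, e ∈ P b a ∧ e ∉ P b c) :
    False := by
  classical
  obtain ⟨e₁, he₁, he₁', he₁''⟩ := d₁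
  obtain ⟨e₂, he₂, he₂', he₂''⟩ := d₂
  obtain ⟨e₃, he₃, he₃', he₃''⟩ := d₃
  obtain ⟨e₄, he₄, he₄', he₄''⟩ := d₄
  have i₁ : SharesInitial (P a a) (P a b) := hP.sharesInitial (.inr h₁)
  have i₂ : SharesInitial (P b b) (P b c) := hP.sharesInitial (.inr h₂)
  -- Otherwise `P a a` would share initial segments with both `P a b` and `P a c`, against `d₁` and
  -- `d₂`.
  have m₁ : N.Meets (P a c) (P b a) := by
    by_contra hm
    refine i₁.not_both (hP.sharesInitial (.inr fun x hx => ?_)) he₁ he₁' he₁'' he₂ he₂' he₂''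
    by_cases hxb : x = b
    · exact hxb ▸ hm
    · exact h₃ x hx hxb
  have m₂ : N.Meets (P b b) (P a a) := by
    by_contra hm
    refine i₂.not_both (hP.sharesInitial (.inl fun x hx => ?_)) he₃ he₃' he₃'' he₄ he₄' he₄''
    by_cases hxa : x = a
    · exact hxa ▸ hm
    · exact h₄ x hxa hx
  -- The detours into the sink `a`: source `a` takes `p` and then `P b a`, source `b` takes `q` and
  -- then `P a a`.
  obtain ⟨p, f, p', hp, ⟨f', hf', hff⟩, hpf⟩ := List.exists_first m₁
  obtain ⟨q, g, q', hq, ⟨g', hg', hgg⟩, hqg⟩ := List.exists_first m₂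
  have hpm : ¬ N.Meets p (P b a) := fun ⟨s, hs, t, ht, hst⟩ => hpf s hs ⟨t, ht, hst⟩
  have hqm : ¬ N.Meets q (P a a) := fun ⟨s, hs, t, ht, hst⟩ => hqg s hs ⟨t, ht, hst⟩
  have hpc : p ⊆ P a c := by rw [hp]; exact List.subset_append_left _ _
  have hqb : q ⊆ P b b := by rw [hq]; exact List.subset_append_left _ _
  have hpa : ∀ x, x ≠ a → ¬ N.Meets p (P x a) := fun x hx hm => by
    by_cases hxb : x = b
    · exact hpm (hxb ▸ hm)
    · exact h₃ x hx hxb (hm.mono hpc (List.Subset.refl _))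
  have hqa : ∀ x, x ≠ b → ¬ N.Meets q (P x a) := fun x hx hm => by
    by_cases hxa : x = a
    · exact hqm (hxa ▸ hm)
    · exact h₄ x hxa hx (hm.mono hqb (List.Subset.refl _))
  obtain ⟨X₁, Y₁, hX₁⟩ := List.append_of_mem hf'
  obtain ⟨X₂, Y₂, hX₂⟩ := List.append_of_mem hg'
  have wp := (hp ▸ hP.isDiWalk a c).split
  have wq := (hq ▸ hP.isDiWalk b b).split
  have w₁ := (hX₁ ▸ hP.isDiWalk b a).split
  have w₂ := (hX₂ ▸ hP.isDiWalk a a).split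
  -- the two detours are disjoint
  have hpq : ¬ N.Meets p q := by
    rintro ⟨m, hm, n, hn, hmn⟩
    obtain ⟨r, r', hr⟩ := List.append_of_mem hm
    obtain ⟨u, u', hu⟩ := List.append_of_mem hn
    have wr : IsDiWalk N.tail N.head (N.source a) r (N.tail n) := by
      rw [hr] at wp; exact hmn ▸ wp.1.split.1
    have wu : IsDiWalk N.tail N.head (N.tail n) (n :: u') (N.tail g') := by
      rw [hu] at wq; exact hgg ▸ wq.1.split.2
    have hrp : r ⊆ p := by rw [hr]; exact List.subset_append_left _ _
    have huq : n :: u' ⊆ q := by rw [hu]; exact List.subset_append_right _ _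
    -- Up to such a meeting `q` would follow `P b a`, so `p` would meet `P b a` already at the tail
    -- of `n`.
    have hub : ¬ N.Meets (n :: u') (P b a) := by
      rintro ⟨s, hs, t, ht, hst⟩
      obtain ⟨v, v', hv⟩ := List.append_of_mem hs
      obtain ⟨z, z', hz⟩ := List.append_of_mem ht
      have := hP.eq_of_first_meet (u := u ++ v) (r := v') (n := s) hq hqa (by simp [hu, hv]) hz hst
      rcases v with _ | ⟨v₀, v⟩
      · rw [List.nil_append, List.cons.injEq] at hv
        exact hpm ⟨m, hm, t, ht, by rw [hmn, hv.1, hst]⟩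
      · rw [List.cons_append, List.cons.injEq] at hv
        refine hpm ⟨m, hm, n, ?_, hmn⟩
        rw [hz, ← this, hv.1]; simp
    -- Passing from `p` to `q` at their common vertex would give the start of `P a a`, although `q`
    -- avoids `P a a`.
    have := hP.eq_of_avoids hX₂ (wr.append wu) fun x hx hm => by
      rcases meets_append_left.1 hm with hm | hm
      · exact hpa x hx (hm.mono hrp (List.Subset.refl _))
      · by_cases hxb : x = b
        · exact hub (hxb ▸ hm)
        · exact hqa x hxb (hm.mono huq (List.Subset.refl _))
    refine hqm (meets_of_mem hn ?_)
    rw [hX₂, ← this]; simp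
  -- Otherwise `p` contains `X₂`, so `e₁`, being off `P a c`, is not before `g'`. Then `g'` is on `P
  -- a b`, which meets `P b b` there.
  have hpY : ¬ N.Meets p (g' :: Y₂) := by
    rintro ⟨m, hm, t, ht, hmt⟩
    obtain ⟨r, r', hr⟩ := List.append_of_mem hm
    obtain ⟨S, T, hS⟩ := List.append_of_mem ht
    have := hP.eq_of_first_meet (X := X₂ ++ S) (h := t) (Y := T) hp hpa hr (by simp [hX₂, hS]) hmt
    have hg : g' ∈ P a b := i₁.mem hX₂ he₁ he₁' fun h => he₁'' <| hpc <| by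
      rw [hr, this]; simp [h]
    exact hP.not_meets hab ⟨g', hg, g, by simp [hq], hgg.symm⟩
  -- Otherwise `q` starts with `X₁`, which misses `e₃` since `e₃` is off `P b a`. Hence `P b c`
  -- passes the tail of `f'`, where it meets `P a c`.
  have hqY : ¬ N.Meets q (f' :: Y₁) := by
    rintro ⟨m, hm, t, ht, hmt⟩
    obtain ⟨r, r', hr⟩ := List.append_of_mem hm
    obtain ⟨S, T, hS⟩ := List.append_of_mem ht
    have hrX := hP.eq_of_first_meet (X := X₁ ++ S) (h := t) (Y := T) hq hqa hr
      (by simp [hX₁, hS]) hmt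
    have hf : N.Meets (P b c) (P a c) := by
      have hex : e₃ ∉ X₁ := fun h => he₃'' <| by rw [hX₁]; simp [h]
      rcases S with _ | ⟨s, S⟩
      · rw [List.nil_append, List.cons.injEq] at hS
        have : m ∈ P b c := i₂.mem (x := X₁) (y := r' ++ g :: q')
          (by rw [hq, hr, hrX]; simp) he₃ he₃' hex
        exact ⟨m, this, f, by simp [hp], by rw [hmt, ← hS.1, hff]⟩
      · rw [List.cons_append, List.cons.injEq] at hS
        have : f' ∈ P b c := i₂.mem (x := X₁) (y := S ++ m :: r' ++ g :: q')
          (by rw [hq, hr, hrX, hS.1]; simp) he₃ he₃' hex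
        exact ⟨f', this, f, by simp [hp], hff.symm⟩
    exact hP.not_meets hab.symm hf
  have := hP.exchange a (Equiv.swap a b)
    (fun i => if i = a then p else if i = b then q else [])
    (fun i => if i = a then X₁ else if i = b then X₂ else [])
    (fun i => if i = a then f' :: Y₁ else if i = b then g' :: Y₂ else P i a)
    (fun i => if i = a then N.tail f else if i = b then N.tail g else N.source i)
    ?_ ?_ ?_ ?_ ?_ a
  · simp only [if_true] at this
    exact hP.not_meets hab (j := a) (meets_of_mem (a := f') (by rw [← this]; simp) hf')
  · intro i
    by_cases hi : i = a
    · simpa [hi] using wp.1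
    by_cases hi' : i = b
    · simpa [hi', hab.symm] using wq.1
    simp [hi, hi', IsDiWalk]
  · intro i
    by_cases hi : i = a
    · simpa [hi, hff] using w₁.2
    by_cases hi' : i = b
    · simpa [hi', hab.symm, hgg] using w₂.2
    simpa [hi, hi'] using hP.isDiWalk i a
  · intro i
    by_cases hi : i = a
    · simpa [hi] using hX₁
    by_cases hi' : i = b
    · simpa [hi', hab.symm] using hX₂
    simp [hi, hi', Equiv.swap_apply_of_ne_of_ne]
  · intro i i' hne hm
    by_cases hi : i = a <;> by_cases hi' : i' = a <;> by_cases hj : i = b <;>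
      by_cases hj' : i' = b <;> subst_vars <;>
      simp_all [not_meets_nil]
    all_goals first
      | exact hpq hm.symm
      | exact not_meets_nil hm.symm
  · intro i i' hne hm
    have hPx : ∀ x, x ≠ a → x ≠ b → N.Meets q (P x a) → False := fun x _ hxb => hqa x hxb
    by_cases hi : i = a <;> by_cases hi' : i' = a <;> by_cases hj : i = b <;>
      by_cases hj' : i' = b <;> subst_vars <;>
      simp_all [not_meets_nil]

end IsUniqueSystem
end PairNetwork

/-! ### Linear orders from acyclic choices on three indices -/

/-- The rank of `a` in the `s`-th of the six linear orders of `0, 1, 2`, read off the digits of a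
numeral. -/
def rankTable (s a : ℕ) : ℕ := 0x192261624 / 4 ^ (3 * s + a) % 4

/-- `f` selects for each index `i` an index related to it, if there is one other than `i`, in such
a way that no nontrivial permutation moves its points as `f` does. -/
def IsAcyclicChoice (M : Fin 3 → Fin 3 → Prop) (f : Fin 3 → Fin 3) : Prop :=
  (∀ i, f i ≠ i → M i (f i)) ∧ (∀ i, f i = i → ∀ x, x ≠ i → ¬ M i x) ∧
    ∀ σ : Equiv.Perm (Fin 3), (∀ i, σ i ≠ i → σ i = f i) → σ = 1

/-- Without a fixed point `f` has a cycle of length two or three, and rotating it is a forbidden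
permutation. -/
theorem exists_fixed_of_perm_eq_one :
    ∀ f : Fin 3 → Fin 3, (∀ σ : Equiv.Perm (Fin 3), (∀ i, σ i ≠ i → σ i = f i) → σ = 1) →
      ∃ i, f i = i := by
  decide +kernel

theorem exists_rank_of_ends :
    ∀ i i' : Fin 3, i ≠ i' →
      ∃ s : Fin 6, ∀ x y : Fin 3, x ≠ y → y ≠ i → x ≠ i' → rankTable s x ≤ rankTable s y := by
  decide +kernel

theorem exists_rank_of_isolated :
    ∀ i m n : Fin 3, i ≠ m → i ≠ n → m ≠ n →
      ∃ s : Fin 6, ∀ x y : Fin 3, x ≠ y → y ≠ i → x ≠ i → ¬ (x = n ∧ y = m) →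
        rankTable s x ≤ rankTable s y := by
  decide +kernel

/-- A fixed point of `f` has no other successor, one of `g` no other predecessor. If they differ,
they go last and first. If they coincide, that index is isolated, and the other two are not related
both ways, since `f` would swap them. -/
theorem exists_rank {M : Fin 3 → Fin 3 → Prop} (h : ∃ f, IsAcyclicChoice M f)
    (h' : ∃ f, IsAcyclicChoice (fun x y => M y x) f) :
    ∃ s : Fin 6, ∀ x y, M x y → rankTable s x ≤ rankTable s y := by
  obtain ⟨f, hf, hf', hσ⟩ := h
  obtain ⟨g, -, hg', hτ⟩ := h'
  obtain ⟨i', hi'⟩ := exists_fixed_of_perm_eq_one f hσ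
  obtain ⟨i, hi⟩ := exists_fixed_of_perm_eq_one g hτ
  have hin : ∀ x y, M x y → x ≠ y → y ≠ i := fun x y hM hxy hy =>
    hg' i hi x (hy ▸ hxy) (hy ▸ hM)
  have hout : ∀ x y, M x y → x ≠ y → x ≠ i' := fun x y hM hxy hx =>
    hf' i' hi' y (hx ▸ hxy.symm) (hx ▸ hM)
  by_cases hii : i = i'
  · subst hii
    obtain ⟨m, n, him, hin', hmn⟩ : ∃ m n : Fin 3, i ≠ m ∧ i ≠ n ∧ m ≠ n :=
      (by decide +kernel : ∀ i : Fin 3, ∃ m n : Fin 3, i ≠ m ∧ i ≠ n ∧ m ≠ n) i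
    have hor : ¬ M m n ∨ ¬ M n m := by
      by_contra hc
      push Not at hc
      have hthree : ∀ i m n x : Fin 3, i ≠ m → i ≠ n → m ≠ n → x ≠ i → x ≠ m → x = n := by
        intros; omega
      have e₁ : f m = n := by
        have h₁ : f m ≠ m := fun h => hf' m h n hmn.symm hc.1
        exact hthree i m n _ him hin' hmn (hin _ _ (hf m h₁) h₁.symm) h₁
      have e₂ : f n = m := by
        have h₁ : f n ≠ n := fun h => hf' n h m hmn hc.2
        exact hthree i n m _ hin' him hmn.symm (hin _ _ (hf n h₁) h₁.symm) h₁
      have := hσ (Equiv.swap m n) fun x hx => by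
        by_cases hxm : x = m
        · rw [hxm, Equiv.swap_apply_left, e₁]
        · by_cases hxn : x = n
          · rw [hxn, Equiv.swap_apply_right, e₂]
          · exact (hx (Equiv.swap_apply_of_ne_of_ne hxm hxn)).elim
      exact hmn (Equiv.swap_eq_one_iff.1 this)
    rcases hor with hor | hor
    · obtain ⟨s, hs⟩ := exists_rank_of_isolated i n m hin' him hmn.symm
      refine ⟨s, fun x y hM => ?_⟩
      by_cases hxy : x = y
      · rw [hxy]
      · exact hs x y hxy (hin x y hM hxy) (hout x y hM hxy) fun h => hor (h.1 ▸ h.2 ▸ hM)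
    · obtain ⟨s, hs⟩ := exists_rank_of_isolated i m n him hin' hmn
      refine ⟨s, fun x y hM => ?_⟩
      by_cases hxy : x = y
      · rw [hxy]
      · exact hs x y hxy (hin x y hM hxy) (hout x y hM hxy) fun h => hor (h.1 ▸ h.2 ▸ hM)
  · obtain ⟨s, hs⟩ := exists_rank_of_ends i i' hii
    refine ⟨s, fun x y hM => ?_⟩
    by_cases hxy : x = y
    · rw [hxy]
    · exact hs x y hxy (hin x y hM hxy) (hout x y hM hxy)

/-! ### The order attached to two sinks -/

namespace PairNetwork.IsUniqueSystem

variable {V A : Type*} {N : PairNetwork V A 3} {P : Fin 3 → Fin 3 → List A}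

/-- `f i` is the source of the first foreign path into `j` that `P i l` meets, or `i` if there is
none. -/
theorem exists_isAcyclicChoice (hP : N.IsUniqueSystem P) (j l : Fin 3) :
    ∃ f, IsAcyclicChoice (fun x y => N.Meets (P x l) (P y j)) f := by
  have key : ∀ i, ∃ m, (m ≠ i → ∃ p g q, P i l = p ++ g :: q ∧
      (∃ g' ∈ P m j, N.tail g = N.tail g') ∧ ∀ x, x ≠ i → ¬ N.Meets p (P x j)) ∧
      (m = i → ∀ x, x ≠ i → ¬ N.Meets (P i l) (P x j)) := by
    intro i
    by_cases h : ∃ g ∈ P i l, ∃ x, x ≠ i ∧ ∃ g' ∈ P x j, N.tail g = N.tail g'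
    · obtain ⟨p, g, q, hpq, ⟨x, hx, g', hg', hgg⟩, hp⟩ := List.exists_first h
      exact ⟨x, fun _ => ⟨p, g, q, hpq, ⟨g', hg', hgg⟩, fun y hy ⟨a, ha, b, hb, hab⟩ =>
        hp a ha ⟨y, hy, b, hb, hab⟩⟩, fun h => (hx h).elim⟩
    · exact ⟨i, fun h => (h rfl).elim, fun _ x hx ⟨a, ha, b, hb, hab⟩ =>
        h ⟨a, ha, x, hx, b, hb, hab⟩⟩
  choose f hf hf' using key
  refine ⟨f, fun i hi => ?_, hf', fun σ hσ => hP.perm_eq_one (j := j) (l := l) σ fun i hi => ?_⟩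
  · obtain ⟨p, g, q, hpq, ⟨g', hg', hgg⟩, -⟩ := hf i hi
    exact ⟨g, by simp [hpq], g', hg', hgg⟩
  · rw [hσ i hi]
    exact hf i (hσ i hi ▸ hi)

/-- The paths into two sinks meet only in accordance with a linear order of the sources. -/
theorem exists_rankTable (hP : N.IsUniqueSystem P) (j l : Fin 3) :
    ∃ s : Fin 6, ∀ x y, N.Meets (P x j) (P y l) → rankTable s x ≤ rankTable s y := by
  refine exists_rank (hP.exists_isAcyclicChoice l j) ?_
  obtain ⟨f, hf, hf', hσ⟩ := hP.exists_isAcyclicChoice j l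
  exact ⟨f, fun i hi => (hf i hi).symm, fun i hi x hx h => hf' i hi x hx h.symm, hσ⟩

end PairNetwork.IsUniqueSystem

/-! ### The table of solutions and the finite check -/

/-- Some routing solutions: the set of the arc types on which the solution respects the capacities,
in binary, the set of the pair types (see `pairIndex`) on which it does not, and the coefficients
`12 * c l i j` in lexicographic order. A type `16 * x + 4 * y + z` stands for the arcs that lie on
`P (x - 1) 0`, `P (y - 1) 1` and `P (z - 1) 2`, where the value `0` of `x`, `y` or `z` means that the
arc lies on no path into the corresponding sink. -/
def routingTable : List (ℕ × ℕ × List ℤ) := [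
  (0x9f9f9f9fffffffff, 0,
    [6, 3, 3, 3, -3, 0, 3, 0, -3, -3, 3, 0, 3, 6, 3, 0, 3, -3, -3, 0, 3, 0, -3, 3, 3, 3, 6]),
  (0xf55ff55ffffff7ff, 0,
    [6, 3, 3, 3, -3, 0, 3, 0, -3, -3, 3, 0, 3, 9, 0, 0, 0, 0, -3, 0, 3, 0, 0, 0, 3, 0, 9]),
  (0x99ffffff98ffffff, 0,
    [9, 0, 3, 0, 0, 0, 3, 0, -3, 0, 0, 0, 0, 9, 3, 0, 3, -3, -3, 0, 3, 0, -3, 3, 3, 3, 6]),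
  (0xffff3f3f3f37ffff, 0,
    [9, 3, 0, 3, -3, 0, 0, 0, 0, -3, 3, 0, 3, 6, 3, 0, 3, -3, 0, 0, 0, 0, -3, 3, 0, 3, 9]),
  (0xf7fff7ff7077f7ff, 0,
    [12, 0, 0, 0, 0, 0, 0, 0, 0, 0, 0, 0, 0, 12, 0, 0, 0, 0, 0, 0, 0, 0, 0, 0, 0, 0, 12]),
  (0xd0ddf5fff8fff5ff, 0,
    [6, 0, 6, 0, 0, 0, 6, 0, -6, 0, 0, 0, 0, 12, 0, 0, 0, 0, -6, 0, 6, 0, 0, 0, 6, 0, 6]),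
  (0xf77f77077f77f77f, 0,
    [6, 6, 0, 6, -6, 0, 0, 0, 0, -6, 6, 0, 6, 6, 0, 0, 0, 0, 0, 0, 0, 0, 0, 0, 0, 0, 12]),
  (0xbfffbfff0833bfff, 0,
    [12, 0, 0, 0, 0, 0, 0, 0, 0, 0, 0, 0, 0, 6, 6, 0, 6, -6, 0, 0, 0, 0, -6, 6, 0, 6, 6]),
  (0xd5ddd5ddffeff7ff, 4,
    [6, 3, 3, 3, -3, 0, 3, 0, -3, -3, 2, 1, 3, 8, 1, 0, 2, -2, -3, -1, 4, 0, -1, 1, 3, 2, 7]),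
  (0xf70ff70ffffdf7ff, 2,
    [6, 3, 3, 3, -3, 0, 3, 0, -3, -3, 4, -1, 3, 7, 2, 0, 1, -1, -3, 1, 2, 0, -2, 2, 3, 1, 8]),
  (0x9999fffff8ff7fff, 64,
    [7, 2, 3, 1, -1, 0, 4, -1, -3, -2, 2, 0, 1, 8, 3, 1, 2, -3, -3, 0, 3, 0, -3, 3, 3, 3, 6]),
  (0xffff0f0f7f77fbff, 8,
    [7, 3, 2, 4, -3, -1, 1, 0, -1, -3, 3, 0, 3, 6, 3, 0, 3, -3, -2, 0, 2, 1, -3, 2, 1, 3, 8]),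
  (0x9ff79fff98ff9fff, 128,
    [8, 1, 3, 2, -2, 0, 2, 1, -3, -1, 1, 0, 2, 7, 3, -1, 4, -3, -3, 0, 3, 0, -3, 3, 3, 3, 6]),
  (0xbfbfbebf3f37bfbf, 32,
    [8, 3, 1, 2, -3, 1, 2, 0, -2, -3, 3, 0, 3, 6, 3, 0, 3, -3, -1, 0, 1, -1, -3, 4, 2, 3, 7]),
  (0xddddddddddfdddff, 2,
    [6, 0, 6, 3, 0, -3, 3, 0, -3, -3, 3, 0, 3, 6, 3, 0, 3, -3, -3, -3, 6, 0, 0, 0, 3, 3, 6]),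
  (0x9001ffffffffffff, 128,
    [6, 3, 3, 0, 0, 0, 6, -3, -3, -3, 3, 0, 3, 6, 3, 0, 3, -3, -3, 0, 3, -3, 0, 3, 6, 0, 6]),
  (0x9fff0fff0fff1fff, 64,
    [6, 3, 3, 3, -3, 0, 3, 0, -3, 0, 0, 0, 3, 6, 3, -3, 6, -3, 0, -3, 3, 0, -3, 3, 0, 6, 6]),
  (0xbbbbbfbfbbbbbbbf, 8,
    [6, 3, 3, 3, -3, 0, 3, 0, -3, 0, 3, -3, 0, 6, 6, 0, 3, -3, 0, 0, 0, -3, -3, 6, 3, 3, 6]),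
  (0xffff0405ffffffff, 32,
    [6, 3, 3, 6, -3, -3, 0, 0, 0, -3, 3, 0, 6, 6, 0, -3, 3, 0, -3, 0, 3, 0, -3, 3, 3, 3, 6]),
  (0xff0fff0fff2fff3f, 4,
    [6, 6, 0, 3, -3, 0, 3, -3, 0, -3, 6, -3, 3, 6, 3, 0, 0, 0, -3, 0, 3, 0, -3, 3, 3, 3, 6]),
  (0xdfdf0d0dffffdbdf, 9,
    [5, 3, 4, 5, -3, -2, 2, 0, -2, -3, 3, 0, 3, 6, 3, 0, 3, -3, -4, 0, 4, 2, -3, 1, 2, 3, 7]),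
  (0x9909ff9fffff7f9f, 65,
    [5, 4, 3, 2, -2, 0, 5, -2, -3, -4, 4, 0, 2, 7, 3, 2, 1, -3, -3, 0, 3, 0, -3, 3, 3, 3, 6]),
  (0x8ddd8ddddfefdfff, 260,
    [6, 3, 3, 3, -3, 0, 3, 0, -3, -3, 1, 2, 3, 7, 2, 0, 4, -4, -3, -2, 5, 0, -2, 2, 3, 4, 5]),
  (0xbf0bbf0bffbdffbf, 18,
    [6, 3, 3, 3, -3, 0, 3, 0, -3, -3, 5, -2, 3, 5, 4, 0, 2, -2, -3, 2, 1, 0, -4, 4, 3, 2, 7]),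
  (0x9ff70f999fff9fff, 144,
    [7, 2, 3, 4, -4, 0, 1, 2, -3, -2, 2, 0, 4, 5, 3, -2, 5, -3, -3, 0, 3, 0, -3, 3, 3, 3, 6]),
  (0x8b8bbebfbfbfbfbf, 288,
    [7, 3, 2, 1, -3, 2, 4, 0, -4, -3, 3, 0, 3, 6, 3, 0, 3, -3, -2, 0, 2, -2, -3, 5, 4, 3, 5])]

/-- The coefficient of the path flow `f_{i,j}` in the `l`-th flow, times `12`. -/
def routingCoeff (L : List ℤ) (l i j : ℕ) : ℤ := L.getD (9 * l + 3 * i + j) 0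

/-- The contribution of the paths into the `j`-th sink to the `l`-th flow on an arc. -/
def routingTerm (L : List ℤ) (l j x : ℕ) : ℤ := if x = 0 then 0 else routingCoeff L l (x - 1) j

/-- The value of the `l`-th flow on the arcs of type `t`. -/
def routingValue (L : List ℤ) (l t : ℕ) : ℤ :=
  routingTerm L l 0 (t / 16) + routingTerm L l 1 (t / 4 % 4) + routingTerm L l 2 (t % 4)

/-- For the arcs on two paths of the source `a` that lie on no path into the sink `l`, the number
`3 * a + l`; for all other types, `9`. -/
def pairIndex (t : ℕ) : ℕ :=
  bif t == 0 then 9 else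
  bif t % 21 == 0 then 9 else
  bif t % 5 == 0 && t.blt 16 then 3 * (t / 5 - 1) else
  bif t % 17 == 0 then 3 * (t / 17 - 1) + 1 else
  bif t % 20 == 0 then 3 * (t / 20 - 1) + 2 else 9

/-- Whether a row of the table consists of a routing solution and its correct type sets. -/
def isRoutingRow (R : ℕ × ℕ × List ℤ) : Bool :=
  ((List.range 64).all fun t => !R.1.testBit t ||
    ((routingValue R.2.2 0 t).natAbs + (routingValue R.2.2 1 t).natAbs +
      (routingValue R.2.2 2 t).natAbs).ble 12) &&
  ((List.range 64).all fun t => R.1.testBit t || (pairIndex t).ble 8 == false ||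
    R.2.1.testBit (pairIndex t)) &&
  ((List.range 3).all fun l => (List.range 3).all fun i =>
    routingCoeff R.2.2 l i 0 + routingCoeff R.2.2 l i 1 + routingCoeff R.2.2 l i 2 ==
      bif i == l then 12 else 0) &&
  ((List.range 3).all fun l => (List.range 3).all fun j =>
    routingCoeff R.2.2 l 0 j + routingCoeff R.2.2 l 1 j + routingCoeff R.2.2 l 2 j ==
      bif j == l then 12 else 0)

theorem routingTable_all_isRoutingRow : routingTable.all isRoutingRow = true := by
  decide +kernel

/-- The rank of the source `a` in the order that belongs to the sinks `j` and `l`. -/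
def sinkRank (s₀₁ s₀₂ s₁₂ j l a : ℕ) : ℕ :=
  match j, l with
  | 0, 1 => rankTable s₀₁ a
  | 1, 0 => 2 - rankTable s₀₁ a
  | 0, 2 => rankTable s₀₂ a
  | 2, 0 => 2 - rankTable s₀₂ a
  | 1, 2 => rankTable s₁₂ a
  | _, _ => 2 - rankTable s₁₂ a

/-- Whether the paths numbered `x` and `y` may share an arc in view of the order `s`. -/
def orderAllows (s x y : ℕ) : Bool :=
  x == 0 || y == 0 || (rankTable s (x - 1)).ble (rankTable s (y - 1))

/-- The consequences of `SharesInitial.not_both` for the code `d`. -/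
def obeysInitial (s₀₁ s₀₂ s₁₂ d : ℕ) : Bool :=
  (List.range 3).all fun a => (List.range 3).all fun j =>
    sinkRank s₀₁ s₀₂ s₁₂ j ((j + 1) % 3) a == 1 || sinkRank s₀₁ s₀₂ s₁₂ j ((j + 2) % 3) a == 1 ||
      !(d.testBit (3 * a + (j + 1) % 3) && d.testBit (3 * a + (j + 2) % 3))

/-- The consequences of `not_crosswise` for the code `d`. -/
def obeysCrosswise (s₀₁ s₀₂ s₁₂ d : ℕ) : Bool :=
  (List.range 3).all fun a => (List.range 3).all fun b => a == b ||
    !(sinkRank s₀₁ s₀₂ s₁₂ a b a == 0 && sinkRank s₀₁ s₀₂ s₁₂ b (3 - a - b) b == 0 &&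
      (sinkRank s₀₁ s₀₂ s₁₂ a (3 - a - b) a).blt (sinkRank s₀₁ s₀₂ s₁₂ a (3 - a - b) (3 - a - b)) &&
      (sinkRank s₀₁ s₀₂ s₁₂ a b b).blt (sinkRank s₀₁ s₀₂ s₁₂ a b (3 - a - b)) &&
      d.testBit (3 * a + (3 - a - b)) && d.testBit (3 * a + b) && d.testBit (3 * b + a) &&
      d.testBit (3 * b + (3 - a - b)))

/-- Whether the solution `R` respects the capacities on all types that the orders allow, apart from
the pair types. -/
def fitsOrders (s₀₁ s₀₂ s₁₂ : ℕ) (R : ℕ × ℕ × List ℤ) : Bool :=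
  (List.range 64).all fun t => R.1.testBit t || (pairIndex t).ble 8 ||
    !(orderAllows s₀₁ (t / 16) (t / 4 % 4) && orderAllows s₀₂ (t / 16) (t % 4) &&
      orderAllows s₁₂ (t / 4 % 4) (t % 4))

/-- Whether some solution of the table fits the orders and respects the capacities on the pair types
in `d`. -/
def isCovered (s₀₁ s₀₂ s₁₂ d : ℕ) : Bool :=
  routingTable.any fun R => R.2.1 &&& d == 0 && fitsOrders s₀₁ s₀₂ s₁₂ R

/-- Whether all orders and all pair codes that obey the two constraints are covered. -/
def allCovered : Bool :=
  (List.range 6).all fun s₀₁ => (List.range 6).all fun s₀₂ => (List.range 6).all fun s₁₂ =>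
    isCovered s₀₁ s₀₂ s₁₂ 511 || (List.range 512).all fun d =>
      !(obeysInitial s₀₁ s₀₂ s₁₂ d && obeysCrosswise s₀₁ s₀₂ s₁₂ d) || isCovered s₀₁ s₀₂ s₁₂ d

theorem allCovered_eq_true : allCovered = true := by
  decide +kernel

theorem rankTable_le_two : ∀ (s : Fin 6) (x : Fin 3), rankTable s x ≤ 2 := by decide +kernel

theorem rankTable_injective :
    ∀ (s : Fin 6) (x y : Fin 3), rankTable s x = rankTable s y → x = y := by
  decide +kernel

theorem sinkRank_le_two (s₀₁ s₀₂ s₁₂ : Fin 6) (j l x : Fin 3) :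
    sinkRank s₀₁ s₀₂ s₁₂ j l x ≤ 2 := by
  have h₁ := rankTable_le_two s₀₁ x
  have h₂ := rankTable_le_two s₀₂ x
  have h₃ := rankTable_le_two s₁₂ x
  fin_cases j <;> fin_cases l <;> simp [sinkRank] <;> omega

theorem sinkRank_injective (s₀₁ s₀₂ s₁₂ : Fin 6) (j l x y : Fin 3)
    (h : sinkRank s₀₁ s₀₂ s₁₂ j l x = sinkRank s₀₁ s₀₂ s₁₂ j l y) : x = y := by
  have h₁ := rankTable_injective s₀₁ x y
  have h₂ := rankTable_injective s₀₂ x y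
  have h₃ := rankTable_injective s₁₂ x y
  have := rankTable_le_two s₀₁ x
  have := rankTable_le_two s₀₂ x
  have := rankTable_le_two s₁₂ x
  have := rankTable_le_two s₀₁ y
  have := rankTable_le_two s₀₂ y
  have := rankTable_le_two s₁₂ y
  fin_cases j <;> fin_cases l <;> simp only [sinkRank] at h <;>
    first
    | exact h₁ (by omega)
    | exact h₂ (by omega)
    | exact h₃ (by omega)

theorem all_range_three {f : ℕ → Bool} (h : ∀ a : Fin 3, f a = true) :
    (List.range 3).all f = true :=
  List.all_eq_true.2 fun a ha => h ⟨a, List.mem_range.1 ha⟩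

theorem exists_routing_row {s₀₁ s₀₂ s₁₂ : Fin 6} {d : ℕ} (hd : d < 512)
    (h₁ : obeysInitial s₀₁ s₀₂ s₁₂ d = true) (h₂ : obeysCrosswise s₀₁ s₀₂ s₁₂ d = true) :
    ∃ R ∈ routingTable, fitsOrders s₀₁ s₀₂ s₁₂ R = true ∧
      ∀ i < 9, d.testBit i = true → R.2.1.testBit i = false := by
  have h := allCovered_eq_true
  simp only [allCovered, List.all_eq_true, List.mem_range] at h
  have h := h _ s₀₁.2 _ s₀₂.2 _ s₁₂.2
  rw [Bool.or_eq_true] at h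
  have key : ∀ d' : ℕ, (∀ i < 9, d.testBit i = true → d'.testBit i = true) →
      isCovered s₀₁ s₀₂ s₁₂ d' = true → ∃ R ∈ routingTable, fitsOrders s₀₁ s₀₂ s₁₂ R = true ∧
      ∀ i < 9, d.testBit i = true → R.2.1.testBit i = false := by
    intro d' hd' hc
    obtain ⟨R, hR, hc⟩ := List.any_eq_true.1 hc
    rw [Bool.and_eq_true, beq_iff_eq] at hc
    refine ⟨R, hR, hc.2, fun i hi hdi => ?_⟩
    have := congrArg (Nat.testBit · i) hc.1
    simpa [Nat.testBit_and, hd' i hi hdi] using this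
  -- `511` has all nine bits set, so a row that covers it serves every `d`.
  rcases h with h | h
  · refine key _ (fun i hi _ => ?_) h
    have := Nat.testBit_two_pow_sub_one 9 i
    simpa [hi] using this
  · have := List.all_eq_true.1 h d (List.mem_range.2 hd)
    rw [h₁, h₂] at this
    exact key d (fun _ _ h => h) (by simpa using this)

/-! ### Multi-flows from coefficient matrices -/

namespace PairNetwork

variable {V A : Type*}

section Flows

variable {k : ℕ} {N : PairNetwork V A k}

/-- A path from a second source ends in `t_j`, which therefore either is that source or has an
incoming arc. With a single pair, source and sink might coincide. -/
theorem source_ne_sink (N : PairNetwork V A k) {P : Fin k → Fin k → List A}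
    (h : N.IsPathSystem P) {i i' : Fin k} (hi : i' ≠ i) (j : Fin k) :
    N.source i ≠ N.sink j := by
  intro hij
  have hw := (h i' j).vertices_eq
  have : N.sink j ∈ N.source i' :: (P i' j).map N.head := by rw [hw]; simp
  rw [← hij, List.mem_cons, List.mem_map] at this
  rcases this with h | ⟨a, -, ha⟩
  · exact hi (N.source_injective h.symm)
  · exact N.head_ne_source a i ha

variable [Fintype A]

theorem excess_sum {ι : Type*} (s : Finset ι) (c : ι → ℝ) (f : ι → A → ℝ) (v : V) :
    N.excess (fun a => ∑ i ∈ s, c i * f i a) v = ∑ i ∈ s, c i * N.excess (f i) v := by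
  simp only [excess, mul_sub, Finset.mul_sum, Finset.sum_sub_distrib]
  congr 1 <;> rw [Finset.sum_comm]

open Classical in
theorem excess_pathFlow {u w : V} {p : List A} (h : IsDiWalk N.tail N.head u p w) (v : V) :
    N.excess (pathFlow p) v = (if v = w then 1 else 0) - if v = u then 1 else 0 := by
  induction p generalizing u with
  | nil => cases h; simp [excess, pathFlow]
  | cons a p ih =>
    have hn := List.nodup_cons.1 (nodup_of_isDiWalk h)
    -- The walk does not repeat `a`, so its indicator is a sum of two; indexing by `Bool` makes
    -- `excess_sum` applicable.
    have hsplit : pathFlow (a :: p) = fun e => ∑ i ∈ (Finset.univ : Finset Bool), (1 : ℝ) *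
        (if i then (fun e => if e = a then (1 : ℝ) else 0) else pathFlow p) e := by
      funext e
      by_cases he : e = a
      · subst he; simp [pathFlow, hn.1]
      · simp [pathFlow, he]
    have hone : N.excess (fun e => if e = a then (1 : ℝ) else 0) v =
        (if v = N.head a then 1 else 0) - if v = u then 1 else 0 := by
      simp only [excess, Finset.sum_ite_eq', Finset.mem_filter, Finset.mem_univ, true_and, h.1,
        eq_comm (a := v)]
    rw [hsplit, excess_sum]
    simp only [Fintype.sum_bool, if_true, one_mul, hone, Bool.false_eq_true, if_false, ih h.2]
    ring

/-- Linear combinations of the path flows whose coefficients have the row and column sums of the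
unit matrices form a multi-flow of rate `(1, …, 1)`. -/
theorem isMultiFlow_of_sums {P : Fin k → Fin k → List A} (hP : N.IsPathSystem P)
    (hst : ∀ i j, N.source i ≠ N.sink j) {c : Fin k → Fin k → Fin k → ℝ}
    (hrow : ∀ l i, ∑ j, c l i j = if i = l then 1 else 0)
    (hcol : ∀ l j, ∑ i, c l i j = if j = l then 1 else 0) :
    N.IsMultiFlow (fun l a => ∑ i, ∑ j, c l i j * pathFlow (P i j) a) ∧
      ∀ l, N.rate (fun l a => ∑ i, ∑ j, c l i j * pathFlow (P i j) a) l = 1 := by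
  classical
  have key : ∀ l v, N.excess (fun a => ∑ i, ∑ j, c l i j * pathFlow (P i j) a) v =
      (if v = N.sink l then 1 else 0) - if v = N.source l then 1 else 0 := by
    intro l v
    have h₁ := N.excess_sum Finset.univ (fun _ => (1 : ℝ))
      (fun i a => ∑ j, c l i j * pathFlow (P i j) a) v
    simp only [one_mul] at h₁
    rw [h₁]
    simp only [excess_sum, excess_pathFlow (hP _ _), mul_sub, Finset.sum_sub_distrib]
    congr 1
    · rw [Finset.sum_comm]
      simp only [← Finset.sum_mul, hcol, ite_mul, one_mul, zero_mul, Finset.sum_ite_eq', Finset.mem_univ,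
        if_true]
    · simp only [← Finset.sum_mul, hrow, ite_mul, one_mul, zero_mul, Finset.sum_ite_eq', Finset.mem_univ,
        if_true]
  refine ⟨fun l v hs ht => ?_, fun l => ?_⟩
  · rw [key]; simp [hs, ht]
  · rw [rate, key]; simp [(hst l l).symm]

end Flows

end PairNetwork

/-! ### From the network to the finite check -/

theorem pairIndex_cases :
    ∀ x y z : Fin 4, pairIndex (16 * x + 4 * y + z) ≤ 8 →
      (x = 0 ∧ y = z ∧ y ≠ 0 ∧ pairIndex (16 * x + 4 * y + z) = 3 * (y - 1 : ℕ)) ∨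
      (y = 0 ∧ z = x ∧ x ≠ 0 ∧ pairIndex (16 * x + 4 * y + z) = 3 * (x - 1 : ℕ) + 1) ∨
      (z = 0 ∧ x = y ∧ x ≠ 0 ∧ pairIndex (16 * x + 4 * y + z) = 3 * (x - 1 : ℕ) + 2) := by
  decide +kernel

namespace PairNetwork.IsUniqueSystem

variable {V A : Type*} {N : PairNetwork V A 3} {P : Fin 3 → Fin 3 → List A}

/-- The arc `e` lies on the path from the source `n - 1` to the sink `j`, or on no path into `j` if
`n = 0`. -/
def IsLabel (P : Fin 3 → Fin 3 → List A) (e : A) (j : Fin 3) (n : Fin 4) : Prop :=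
  ∀ i : Fin 3, e ∈ P i j ↔ (n : ℕ) = i + 1

theorem exists_isLabel (hP : N.IsUniqueSystem P) (e : A) (j : Fin 3) : ∃ n, IsLabel P e j n := by
  by_cases h : ∃ i, e ∈ P i j
  · obtain ⟨i, hi⟩ := h
    refine ⟨⟨i + 1, by omega⟩, fun i' => ⟨fun hi' => ?_, fun h => ?_⟩⟩
    · by_contra hne
      exact hP.not_meets (fun h => hne (by rw [h])) (meets_of_mem hi hi')
    · rwa [← (Fin.ext (by simpa using h) : i = i')]
  · exact ⟨0, fun i => ⟨fun hi => (h ⟨i, hi⟩).elim, fun hi => by simp at hi⟩⟩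

theorem sum_pathFlow {e : A} {j : Fin 3} {n : Fin 4} (h : IsLabel P e j n) (L : List ℤ)
    (l : Fin 3) :
    ∑ i : Fin 3, (routingCoeff L l i j / 12 : ℝ) * pathFlow (P i j) e = routingTerm L l j n / 12 := by
  have hf : ∀ i : Fin 3, pathFlow (P i j) e = if (n : ℕ) = i + 1 then 1 else 0 := fun i => by
    simp only [pathFlow, h i]
  simp only [hf, Fin.sum_univ_three]
  fin_cases n <;> simp [routingTerm]

theorem sinkRank_le (s₀₁ s₀₂ s₁₂ : Fin 6)
    (h₀₁ : ∀ x y, N.Meets (P x 0) (P y 1) → rankTable s₀₁ x ≤ rankTable s₀₁ y)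
    (h₀₂ : ∀ x y, N.Meets (P x 0) (P y 2) → rankTable s₀₂ x ≤ rankTable s₀₂ y)
    (h₁₂ : ∀ x y, N.Meets (P x 1) (P y 2) → rankTable s₁₂ x ≤ rankTable s₁₂ y)
    {j l x y : Fin 3} (hjl : j ≠ l) (h : N.Meets (P x j) (P y l)) :
    sinkRank s₀₁ s₀₂ s₁₂ j l x ≤ sinkRank s₀₁ s₀₂ s₁₂ j l y := by
  fin_cases j <;> fin_cases l <;> first
    | exact (hjl rfl).elim
    | exact h₀₁ x y h
    | exact h₀₂ x y h
    | exact h₁₂ x y h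
    | exact Nat.sub_le_sub_left (h₀₁ y x h.symm) 2
    | exact Nat.sub_le_sub_left (h₀₂ y x h.symm) 2
    | exact Nat.sub_le_sub_left (h₁₂ y x h.symm) 2

/-- Two paths of the source `a` share an arc off the path from `a` to the sink `l`. -/
def HasPairArc (P : Fin 3 → Fin 3 → List A) (a l : Fin 3) : Prop :=
  ∃ e ∈ P a (l + 1), e ∈ P a (l + 2) ∧ e ∉ P a l

open Classical in
theorem exists_pairCode (P : Fin 3 → Fin 3 → List A) :
    ∃ d < 512, ∀ a l : Fin 3, d.testBit (3 * a + l) = true ↔ HasPairArc P a l := by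
  refine ⟨Nat.ofBits (n := 9) fun i => decide (HasPairArc P ⟨i / 3, by omega⟩ ⟨i % 3, by omega⟩),
    Nat.ofBits_lt_two_pow _, fun a l => ?_⟩
  rw [Nat.testBit_ofBits_lt _ _ (by omega), decide_eq_true_iff]
  have h₁ : (⟨(3 * a + l : ℕ) / 3, by omega⟩ : Fin 3) = a := Fin.ext (by simp only; omega)
  have h₂ : (⟨(3 * a + l : ℕ) % 3, by omega⟩ : Fin 3) = l := Fin.ext (by simp only; omega)
  rw [h₁, h₂]

section Orders

variable {s₀₁ s₀₂ s₁₂ : Fin 6} {d : ℕ}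

/-- A source of rank 0 or 2 can meet foreign paths in one direction only, which is what
`sharesInitial` needs; rank 1 gives nothing. -/
theorem obeysInitial (hP : N.IsUniqueSystem P)
    (hs : ∀ j l x y : Fin 3, j ≠ l → N.Meets (P x j) (P y l) →
      sinkRank s₀₁ s₀₂ s₁₂ j l x ≤ sinkRank s₀₁ s₀₂ s₁₂ j l y)
    (hd : ∀ a l : Fin 3, d.testBit (3 * a + l) = true ↔ HasPairArc P a l) :
    obeysInitial s₀₁ s₀₂ s₁₂ d = true := by
  have hinit : ∀ a j l : Fin 3, j ≠ l → sinkRank s₀₁ s₀₂ s₁₂ j l a ≠ 1 →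
      SharesInitial (P a j) (P a l) := by
    intro a j l hjl hr
    have h₂ := sinkRank_le_two s₀₁ s₀₂ s₁₂ j l a
    refine hP.sharesInitial ?_
    rcases (by omega : sinkRank s₀₁ s₀₂ s₁₂ j l a = 0 ∨ sinkRank s₀₁ s₀₂ s₁₂ j l a = 2) with h | h
    · refine .inr fun x hx hm => hx (sinkRank_injective s₀₁ s₀₂ s₁₂ j l _ _ ?_)
      have := hs j l x a hjl hm.symm
      omega
    · refine .inl fun x hx hm => hx (sinkRank_injective s₀₁ s₀₂ s₁₂ j l _ _ ?_)
      have := hs j l a x hjl hm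
      have := sinkRank_le_two s₀₁ s₀₂ s₁₂ j l x
      omega
  refine all_range_three fun a => all_range_three fun j => ?_
  by_contra hc
  have e₁ : ((j : ℕ) + 1) % 3 = ((j + 1 : Fin 3) : ℕ) := by fin_cases j <;> rfl
  have e₂ : ((j : ℕ) + 2) % 3 = ((j + 2 : Fin 3) : ℕ) := by fin_cases j <;> rfl
  rw [e₁, e₂] at hc
  simp only [Bool.or_eq_true, beq_iff_eq, Bool.not_eq_true', Bool.and_eq_false_iff, not_or,
    Bool.not_eq_false, hd] at hc
  obtain ⟨⟨h₁, h₂⟩, ⟨e, he, he', he''⟩, f, hf, hf', hf''⟩ := hc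
  have e₃ : j + 1 + 2 = j := by fin_cases j <;> rfl
  have e₄ : j + 2 + 1 = j := by fin_cases j <;> rfl
  have e₅ : j + 2 + 2 = j + 1 := by fin_cases j <;> rfl
  have e₆ : j + 1 + 1 = j + 2 := by fin_cases j <;> rfl
  rw [e₃] at he'
  rw [e₆] at he
  rw [e₄] at hf
  rw [e₅] at hf'
  exact (hinit a j _ (by fin_cases j <;> decide) h₂).not_both
    (hinit a j _ (by fin_cases j <;> decide) h₁) he' he he'' hf hf' hf''

theorem HasPairArc.exists {a j m l : Fin 3} (h : HasPairArc P a l) (hjm : j ≠ m) (hjl : j ≠ l)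
    (hml : m ≠ l) : ∃ e ∈ P a j, e ∈ P a m ∧ e ∉ P a l := by
  obtain ⟨e, he, he', he''⟩ := h
  have : j = l + 1 ∧ m = l + 2 ∨ j = l + 2 ∧ m = l + 1 := by
    clear he he' he''
    revert j m l; decide +kernel
  rcases this with ⟨rfl, rfl⟩ | ⟨rfl, rfl⟩
  · exact ⟨e, he, he', he''⟩
  · exact ⟨e, he', he, he''⟩

/-- Rank 0 leaves no foreign source that could be met from below, and the strict inequalities rule
out meetings with the third source; these are the hypotheses of `not_crosswise`. -/
theorem obeysCrosswise (hP : N.IsUniqueSystem P)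
    (hs : ∀ j l x y : Fin 3, j ≠ l → N.Meets (P x j) (P y l) →
      sinkRank s₀₁ s₀₂ s₁₂ j l x ≤ sinkRank s₀₁ s₀₂ s₁₂ j l y)
    (hd : ∀ a l : Fin 3, d.testBit (3 * a + l) = true ↔ HasPairArc P a l) :
    obeysCrosswise s₀₁ s₀₂ s₁₂ d = true := by
  refine all_range_three fun a => all_range_three fun b => ?_
  by_contra hc
  obtain ⟨hab, h⟩ : a ≠ b ∧ _ := by
    simpa only [Bool.or_eq_true, beq_iff_eq, not_or, Bool.not_eq_true', Bool.not_eq_false,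
      Fin.val_inj] using hc
  obtain ⟨c, hca, hcb, hc⟩ : ∃ c : Fin 3, c ≠ a ∧ c ≠ b ∧ 3 - (a : ℕ) - b = c :=
    (by decide +kernel : ∀ a b : Fin 3, a ≠ b →
      ∃ c : Fin 3, c ≠ a ∧ c ≠ b ∧ 3 - (a : ℕ) - b = c) a b hab
  have hthree : ∀ x, x ≠ a → x ≠ b → x = c := by intros; omega
  rw [hc] at h
  simp only [Bool.and_eq_true, beq_iff_eq, Nat.blt_eq, hd] at h
  obtain ⟨⟨⟨⟨⟨⟨⟨h₁, h₂⟩, h₃⟩, h₄⟩, d₁⟩, d₂⟩, d₃⟩, d₄⟩ := h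
  refine hP.not_crosswise hab (c := c) (fun x hx hm => hx ?_) (fun x hx hm => hx ?_)
    (fun x hxa hxb hm => ?_) (fun x hxa hxb hm => ?_) (d₁.exists hab hca.symm hcb.symm)
    (d₂.exists hca.symm hab hcb) (d₃.exists hcb.symm hab.symm hca)
    (d₄.exists hab.symm hcb.symm hca.symm)
  · have := hs a b x a hab hm.symm
    exact sinkRank_injective s₀₁ s₀₂ s₁₂ a b _ _ (by omega)
  · have := hs b c x b hcb.symm hm.symm
    exact sinkRank_injective s₀₁ s₀₂ s₁₂ b c _ _ (by omega)
  · obtain rfl := hthree x hxa hxb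
    have := hs a x x a hca.symm hm.symm
    omega
  · obtain rfl := hthree x hxa hxb
    have := hs a b x b hab hm.symm
    omega

end Orders

theorem exists_routingSolution [Fintype A] (hP : N.IsUniqueSystem P) :
    ∃ F : Fin 3 → A → ℝ, N.IsRoutingSolution F ∧ IsLinearMultiFlow P F := by
  obtain ⟨s₀₁, h₀₁⟩ := hP.exists_rankTable 0 1
  obtain ⟨s₀₂, h₀₂⟩ := hP.exists_rankTable 0 2
  obtain ⟨s₁₂, h₁₂⟩ := hP.exists_rankTable 1 2
  obtain ⟨d, hd, hdP⟩ := exists_pairCode P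
  have hs : ∀ j l x y : Fin 3, j ≠ l → N.Meets (P x j) (P y l) →
      sinkRank s₀₁ s₀₂ s₁₂ j l x ≤ sinkRank s₀₁ s₀₂ s₁₂ j l y :=
    fun j l x y => sinkRank_le s₀₁ s₀₂ s₁₂ h₀₁ h₀₂ h₁₂
  obtain ⟨R, hR, hfit, hpair⟩ := exists_routing_row hd (hP.obeysInitial hs hdP)
    (hP.obeysCrosswise hs hdP)
  have hrow := List.all_eq_true.1 routingTable_all_isRoutingRow R hR
  simp only [isRoutingRow, Bool.and_eq_true, List.all_eq_true, List.mem_range, beq_iff_eq] at hrow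
  obtain ⟨⟨⟨hcap, hidx⟩, hrow⟩, hcol⟩ := hrow
  have hsystem := (isExtraStrongPathSystem_iff.1 hP.1).1
  have hst : ∀ i j, N.source i ≠ N.sink j := fun i j =>
    N.source_ne_sink hsystem (i' := i + 1) (by fin_cases i <;> decide) j
  let c : Fin 3 → Fin 3 → Fin 3 → ℝ := fun l i j => routingCoeff R.2.2 l i j / 12
  have hflow := isMultiFlow_of_sums hsystem hst (c := c) ?_ ?_
  · refine ⟨_, ⟨hflow.1, hflow.2, fun e => ?_⟩, fun l => ⟨c l, fun a => rfl⟩⟩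
    obtain ⟨x, hx⟩ := hP.exists_isLabel e 0
    obtain ⟨y, hy⟩ := hP.exists_isLabel e 1
    obtain ⟨z, hz⟩ := hP.exists_isLabel e 2
    have ht : (16 * x + 4 * y + z : ℕ) < 64 := by omega
    have ht₁ : (16 * x + 4 * y + z : ℕ) / 16 = x := by omega
    have ht₂ : (16 * x + 4 * y + z : ℕ) / 4 % 4 = y := by omega
    have ht₃ : (16 * x + 4 * y + z : ℕ) % 4 = z := by omega
    have hval : ∀ l : Fin 3, ∑ i, ∑ j, c l i j * pathFlow (P i j) e =
        ((routingValue R.2.2 l (16 * x + 4 * y + z) : ℤ) : ℝ) / 12 := by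
      intro l
      rw [Finset.sum_comm, Fin.sum_univ_three]
      simp only [c]
      rw [sum_pathFlow hx, sum_pathFlow hy, sum_pathFlow hz, routingValue, ht₁, ht₂, ht₃]
      push_cast
      simp only [Fin.val_zero, Fin.val_one, Fin.val_two]
      ring
    have hle : (routingValue R.2.2 0 (16 * x + 4 * y + z)).natAbs +
        (routingValue R.2.2 1 (16 * x + 4 * y + z)).natAbs +
        (routingValue R.2.2 2 (16 * x + 4 * y + z)).natAbs ≤ 12 := by
      -- The orders allow the type of `e`, so a failing type would be a pair type listed in `R.2.1`.
      -- But `e` itself puts this pair type into `d`, on which `R` was chosen not to fail.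
      have hbit : R.1.testBit (16 * x + 4 * y + z) = true := by
        by_contra hbit
        have hfit := List.all_eq_true.1 hfit _ (List.mem_range.2 ht)
        have hor : ∀ {s : Fin 6} {j l : Fin 3} {x y : Fin 4}, IsLabel P e j x → IsLabel P e l y →
            (∀ x y, N.Meets (P x j) (P y l) → rankTable s x ≤ rankTable s y) →
            orderAllows s x y = true := by
          intro s j l x y hx hy h
          by_contra hc
          simp only [orderAllows, Bool.or_eq_true, beq_iff_eq, Nat.ble_eq, not_or] at hc
          have h₁ := (hx ⟨x - 1, by omega⟩).2 (by simp only; omega)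
          have h₂ := (hy ⟨y - 1, by omega⟩).2 (by simp only; omega)
          exact hc.2 (h _ _ (meets_of_mem h₁ h₂))
        rw [ht₁, ht₂, ht₃, hor hx hy h₀₁, hor hx hz h₀₂, hor hy hz h₁₂] at hfit
        have h8 : pairIndex (16 * x + 4 * y + z) ≤ 8 := by simpa [hbit] using hfit
        have hE : R.2.1.testBit (pairIndex (16 * x + 4 * y + z)) = true := by
          simpa [hbit, Nat.ble_eq_true_of_le h8] using hidx _ ht
        refine Bool.eq_false_iff.1 (hpair _ (Nat.lt_succ_of_le h8) ?_) hE
        have hlab : ∀ {i j l m : Fin 3} {u v w : Fin 4}, IsLabel P e j u → IsLabel P e l v →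
            IsLabel P e m w → u ≠ 0 → u = v → w = 0 → (i : ℕ) = (u : ℕ) - 1 →
            e ∈ P i j ∧ e ∈ P i l ∧ e ∉ P i m := by
          intro i j l m u v w hu hv hw hu0 huv hw0 hi
          subst huv hw0
          have : (u : ℕ) ≠ 0 := fun h => hu0 (Fin.ext h)
          refine ⟨(hu i).2 (by omega), (hv i).2 (by omega), fun h => ?_⟩
          have := (hw i).1 h
          simp at this
        rcases pairIndex_cases x y z h8 with ⟨h0, h1, h2, h3⟩ | ⟨h0, h1, h2, h3⟩ | ⟨h0, h1, h2, h3⟩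
        · rw [h3]
          exact (hdP ⟨y - 1, by omega⟩ 0).2 ⟨e, hlab hy hz hx h2 h1 h0 rfl⟩
        · rw [h3]
          have := hlab (i := ⟨x - 1, by omega⟩) hz hx hy (h1 ▸ h2) h1 h0
            (show (x : ℕ) - 1 = (z : ℕ) - 1 by rw [h1])
          exact (hdP ⟨x - 1, by omega⟩ 1).2 ⟨e, this⟩
        · rw [h3]
          exact (hdP ⟨x - 1, by omega⟩ 2).2 ⟨e, hlab hx hy hz h2 h1 h0 rfl⟩
      simpa [hbit] using hcap _ ht
    simp only [hval]
    simp only [Fin.sum_univ_three, abs_div, Nat.abs_ofNat, ← add_div]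
    rw [div_le_one (by norm_num)]
    have hcast : ∀ a : ℤ, |(a : ℝ)| = (a.natAbs : ℝ) := fun a => by
      rw [Nat.cast_natAbs, Int.cast_abs]
    simp only [hcast, Fin.val_zero, Fin.val_one, Fin.val_two]
    exact_mod_cast hle
  · intro l i
    have := hrow l l.2 i i.2
    simp only [c, Fin.sum_univ_three, ← add_div, Fin.val_zero, Fin.val_one, Fin.val_two]
    have h' : ((routingCoeff R.2.2 l i 0 + routingCoeff R.2.2 l i 1 + routingCoeff R.2.2 l i 2 : ℤ) :
        ℝ) = if i = l then 12 else 0 := by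
      rw [this]
      by_cases h : i = l
      · simp [h]
      · rw [beq_false_of_ne (Fin.val_ne_of_ne h)]; simp [h]
    push_cast at h'
    rw [h']; split_ifs <;> norm_num
  · intro l j
    have := hcol l l.2 j j.2
    simp only [c, Fin.sum_univ_three, ← add_div, Fin.val_zero, Fin.val_one, Fin.val_two]
    have h' : ((routingCoeff R.2.2 l 0 j + routingCoeff R.2.2 l 1 j + routingCoeff R.2.2 l 2 j : ℤ) :
        ℝ) = if j = l then 12 else 0 := by
      rw [this]
      by_cases h : j = l
      · simp [h]
      · rw [beq_false_of_ne (Fin.val_ne_of_ne h)]; simp [h]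
    push_cast at h'
    rw [h']; split_ifs <;> norm_num

end PairNetwork.IsUniqueSystem

theorem mainTheorem1 {V A : Type*} [Fintype V] [Fintype A] (N : PairNetwork V A 3)
    (hN : N.IsStable ∨ N.IsExtraStable) :
    ∃ P : Fin 3 → Fin 3 → List A, N.IsExtraStrongPathSystem P ∧
      ∃ F : Fin 3 → A → ℝ, N.IsRoutingSolution F ∧ IsLinearMultiFlow P F := by
  -- `id` suffices for the second case because `IsUniqueSystem` unfolds to the body of `∃!`.
  obtain ⟨P, hP⟩ : ∃ P, N.IsUniqueSystem P := hN.elim (·.exists_isUniqueSystem) id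
  exact ⟨P, hP.1, hP.exists_routingSolution⟩
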